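/- \textbf{Game.} Let $N$ be a finite set of players; each $n\in N$ has a finite nonempty totally ordered type space $T_n$ and an action space $A_n\subset\mathbb R$ that is a nonempty finite set or a nonempty compact interval. Write $T_{-n}=\prod_{m\ne n}T_m$ and $A_{-n}=\prod_{m\neq n}A_m$, ordered componentwise. The state space is $\tilde\Omega=\prod_{k=1}^{\bar k}\tilde\Omega_k$ with the componentwise order, each $\tilde\Omega_k\subset\mathbb R$ being a nonempty finite set or a nonempty compact interval. For $n\in N$, $t_n\in T_n$, $t_{-n}\in T_{-n}$ there are a continuous payoff-utility $\tilde u_{n,t_n,t_{-n}}:A_n\times A_{-n}\times\tilde\Omega\to\mathbb R$, a probability $p_{n,t_n}=(p_{n,t_n|t_{-n}})_{t_{-n}\in T_{-n}}$ on $T_{-n}$, a set $\tilde P_{n,t_n,t_{-n}}\subseteq\mathcal P(\tilde\Omega)$ of Borel probabilities and a set $\mathcal K_{n,t_n}\subseteq\mathcal P(\tilde\Omega)^{T_{-n}}$ such that $\mathcal Q_{n,t_n}=\big(\prod_{t_{-n}}\tilde P_{n,t_n,t_{-n}}\big)\cap\mathcal K_{n,t_n}$ is nonempty. A behavioral-strategy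 profile is $\delta=(\delta_{n,t_n})$ with $\delta_{n,t_n}\in\mathcal P(A_n)$. The $(n,t_n)$-player values a family $\pi=(\pi_{t_{-n}}(\omega))_{t_{-n}\in T_{-n},\,\omega\in\tilde\Omega}$ of distributions of payoff-utility by $$s_{n,t_n}(\pi)=\sup_{\nu\in\mathcal Q_{n,t_n}}\ \sum_{t_{-n}}p_{n,t_n|t_{-n}}\int_{\tilde\Omega}\int_{\mathbb R} x\;\pi_{t_{-n}}(\omega)(dx)\;\nu_{t_{-n}}(d\omega).$$ Let $s^{a}_{n,t_n}(a_n,\delta_{-n})$ (resp. $s^{d}_{n,t_n}(d_n,\delta_{-n})$) be the value of the family where $\pi_{t_{-n}}(\omega)$ is the law of $\tilde u_{n,t_n,t_{-n}}(\cdot,\cdot,\omega)$ when the opponents' actions are drawn from $\prod_{m\ne n}\delta_{m,t_m}$ and player $n$ uses the action $a_n\in A_n$ (resp. independently draws his action from $d_n\in\mathcal P(A_n)$). The profile $\delta$ is an \emph{action-based equilibrium} if, for all $n,t_n$, $\delta_{n,t_n}$ gives probability $1$ to the set of maximizers of $s^{a}_{n,t_n}(\cdot,\delta_{-n})$ over $A_n$;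 it is a \emph{distribution-based equilibrium} if, for all $n,t_n$, $\delta_{n,t_n}$ maximizes $s^{d}_{n,t_n}(\cdot,\delta_{-n})$ over $\mathcal P(A_n)$. \textbf{Orders.} For $\mu^1,\mu^2\in\mathcal P(\tilde\Omega)$ write $\mu^1\le\mu^2$ (usual stochastic order) if $\int q\,d\mu^1\le\int q\,d\mu^2$ for every increasing measurable $q:\tilde\Omega\to\mathbb R$ integrable under both. Let $\mu^1\vee\mu^2$ and $\mu^1\wedge\mu^2$ be the least upper and greatest lower bound in $\mathcal P(\tilde\Omega)$ for this order, when they exist. For $P^1,P^2\subseteq\mathcal P(\tilde\Omega)$ write $P^1\le P^2$ if for all $\mu^1\in P^1$, $\mu^2\in P^2$ both $\mu^1\wedge\mu^2$ and $\mu^1\vee\mu^2$ exist, $\mu^1\wedge\mu^2\in P^1$ and $\mu^1\vee\mu^2\in P^2$; call $P$ a sublattice if $P\le P$. A real function $f(x,y)$ on a product of ordered sets has increasing differences between $x$ and $y$ if $f(x^2,y)-f(x^1,y)$ is increasing in $y$ whenever $x^1\le x^2$. $\mathcal M(X,Y)$ is the set of increasing maps $X\to Y$, ordered pointwise. \textbf{Assumptions.}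 (1) $\tilde u_{n,t_n,t_{-n}}(a_n,a_{-n},\tilde\omega)$ is increasing in $\tilde\omega$. (2) For each $n$ it has increasing differences between $a_n$ and $(t_n,t_{-n},a_{-n},\tilde\omega)$, and, at each fixed $a_n$, between $(t_n,t_{-n},a_{-n})$ and $\tilde\omega$. (3) $\sum_{t_{-n}}p_{n,t_n|t_{-n}}f(t_{-n})$ is increasing in $t_n$ for every increasing $f:T_{-n}\to\mathbb R$. (4) Each $\tilde P_{n,t_n,t_{-n}}$ is a sublattice. (5) $\tilde P_{n,t_n,t_{-n}}$ is increasing in $t_n$, i.e. $t_n^1\le t_n^2$ implies $\tilde P_{n,t_n^1,t_{-n}}\le\tilde P_{n,t_n^2,t_{-n}}$. (6) One of two scenarios holds. Scenario A: $p_{n,t_n}$ does not depend on $t_n$, and every $\mathcal K_{n,t_n}=\mathcal M(T_{-n},\mathcal P(\tilde\Omega))$. Scenario B: $\tilde P_{n,t_n,t_{-n}}$ does not depend on $t_{-n}$, and every $\mathcal K_{n,t_n}$ is the set of constant maps $T_{-n}\to\mathcal P(\tilde\Omega)$. \textbf{Best responses.} For $a_n\in A_n$ and $a_{-n}=(a_m)_{m\ne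 n}\in\prod_{m\ne n}\mathcal M(T_m,A_m)$ put $$\tilde s_{n,t_n}(a_n,a_{-n})=\sup_{\nu\in\mathcal Q_{n,t_n}}\sum_{t_{-n}}p_{n,t_n|t_{-n}}\int_{\tilde\Omega}\tilde u_{n,t_n,t_{-n}}\big(a_n,(a_{m}(t_m))_{m\ne n},\tilde\omega\big)\,\nu_{t_{-n}}(d\tilde\omega).$$ For $a\in\prod_n\mathcal M(T_n,A_n)$ let $\tilde{\mathcal B}(a)$ be the set of $a'\in\prod_n\mathcal M(T_n,A_n)$ such that, for all $n$ and $t_n$, $a'_n(t_n)$ maximizes $\tilde s_{n,t_n}(\cdot,a_{-n})$ over $A_n$. \textbf{Theorem.} Under (1)--(6), the set $\tilde{\mathcal E}=\{a\in\prod_{n}\mathcal M(T_n,A_n): a\in\tilde{\mathcal B}(a)\}$ of fixed points of $\tilde{\mathcal B}$, with the order induced from $\prod_n\mathcal M(T_n,A_n)$, is a nonempty complete lattice: every subset of $\tilde{\mathcal E}$ has a least upper bound and a greatest lower bound in $\tilde{\mathcal E}$. Moreover, for $a\in\prod_n\mathcal M(T_n,A_n)$, the following are equivalent: $a\in\tilde{\mathcal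 E}$; the pure profile $(\mathrm{Dirac}_{a_n(t_n)})_{n,t_n}$ is an action-based equilibrium; this pure profile is a distribution-based equilibrium. Hence pure, type-monotone equilibria exist, in both senses, and there are a smallest and a largest one. -/

import Mathlib

open MeasureTheory

noncomputable section

namespace Enterprising

/-- `f` has increasing differences between `x` and `y`. -/
def IncDiff {X Y : Type*} [Preorder X] [Preorder Y] (f : X → Y → ℝ) : Prop :=
  ∀ ⦃x₁ x₂ : X⦄, x₁ ≤ x₂ → ∀ ⦃y₁ y₂ : Y⦄, y₁ ≤ y₂ → f x₂ y₁ - f x₁ y₁ ≤ f x₂ y₂ - f x₁ y₂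

section StochasticOrder

variable {S : Type*} [MeasurableSpace S] [Preorder S]

/-- The usual stochastic order on Borel probabilities over an ordered space. -/
def StLE (μ₁ μ₂ : ProbabilityMeasure S) : Prop :=
  ∀ q : S → ℝ, Monotone q → Measurable q →
    Integrable q (μ₁ : Measure S) → Integrable q (μ₂ : Measure S) →
      ∫ x, q x ∂(μ₁ : Measure S) ≤ ∫ x, q x ∂(μ₂ : Measure S)

/-- `j` is the join (least upper bound) of `μ₁` and `μ₂` in the stochastic order on all
probabilities over `S`. -/
def IsStJoin (μ₁ μ₂ j : ProbabilityMeasure S) : Prop :=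
  StLE μ₁ j ∧ StLE μ₂ j ∧ ∀ ρ, StLE μ₁ ρ → StLE μ₂ ρ → StLE j ρ

/-- `m` is the meet (greatest lower bound) of `μ₁` and `μ₂` in the stochastic order on all
probabilities over `S`. -/
def IsStMeet (μ₁ μ₂ m : ProbabilityMeasure S) : Prop :=
  StLE m μ₁ ∧ StLE m μ₂ ∧ ∀ ρ, StLE ρ μ₁ → StLE ρ μ₂ → StLE ρ m

/-- The induced set order: for `μ₁ ∈ P₁` and `μ₂ ∈ P₂`, the meet of `μ₁` and `μ₂` lies in `P₁`
and their join lies in `P₂`. -/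
def InducedSetLE (P₁ P₂ : Set (ProbabilityMeasure S)) : Prop :=
  ∀ μ₁ ∈ P₁, ∀ μ₂ ∈ P₂,
    (∃ m ∈ P₁, IsStMeet μ₁ μ₂ m) ∧ (∃ j ∈ P₂, IsStJoin μ₁ μ₂ j)

/-- `P` is closed under pairwise meets and joins, taken among all probabilities over `S`. -/
def IsStSublattice (P : Set (ProbabilityMeasure S)) : Prop :=
  ∀ μ₁ ∈ P, ∀ μ₂ ∈ P, (∃ m ∈ P, IsStMeet μ₁ μ₂ m) ∧ (∃ j ∈ P, IsStJoin μ₁ μ₂ j)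

end StochasticOrder

/-- Opponents' type profiles. -/
abbrev OppType {ι : Type*} (T : ι → Type*) (n : ι) : Type _ := (m : {m : ι // m ≠ n}) → T m

/-- Opponents' action profiles. -/
abbrev OppAct {ι : Type*} (A : ι → Set ℝ) (n : ι) : Type _ := (m : {m : ι // m ≠ n}) → A m

/-- The state space, a product of subsets of the real line. -/
abbrev State {k : ℕ} (W : Fin k → Set ℝ) : Type := (i : Fin k) → W i

/-- A nonempty finite set or nonempty compact interval of reals. -/
def FiniteOrInterval (s : Set ℝ) : Prop :=
  s.Nonempty ∧ (s.Finite ∨ ∃ l r : ℝ, s = Set.Icc l r)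

/-- The special enterprising game with players `ι`, type spaces `T n`, action spaces `A n` and
state space `∏ i, W i`. -/
structure Game (ι : Type*) [Fintype ι] [DecidableEq ι] (T : ι → Type*) [∀ n, Fintype (T n)]
    (A : ι → Set ℝ) {k : ℕ} (W : Fin k → Set ℝ) where
  act_shape : ∀ n, FiniteOrInterval (A n)
  state_shape : ∀ i, FiniteOrInterval (W i)
  /-- payoff-utility `u n tₙ t₋ₙ aₙ a₋ₙ ω` -/
  u : (n : ι) → T n → OppType T n → A n → OppAct A n → State W → ℝ
  u_cont : ∀ n t s, Continuous fun x : A n × OppAct A n × State W => u n t s x.1 x.2.1 x.2.2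
  /-- probability that player `n` of the given type assigns to an opponent type profile -/
  p : (n : ι) → T n → OppType T n → ℝ
  p_nonneg : ∀ n t s, 0 ≤ p n t s
  p_sum : ∀ n t, ∑ s, p n t s = 1
  /-- prior sets on states, for each opponent type profile -/
  prior : (n : ι) → T n → OppType T n → Set (ProbabilityMeasure (State W))
  /-- joint restriction on the vector of priors -/
  K : (n : ι) → T n → Set (OppType T n → ProbabilityMeasure (State W))
  prior_nonempty : ∀ n t, {ν | (∀ s, ν s ∈ prior n t s) ∧ ν ∈ K n t}.Nonempty

namespace Game

variable {ι : Type*} [Fintype ι] [DecidableEq ι] {T : ι → Type*} [∀ n, Fintype (T n)]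
  {A : ι → Set ℝ} {k : ℕ} {W : Fin k → Set ℝ}

/-- The set of admissible prior vectors of player `n` with type `t`. -/
def Q (G : Game ι T A W) (n : ι) (t : T n) : Set (OppType T n → ProbabilityMeasure (State W)) :=
  {ν | (∀ s, ν s ∈ G.prior n t s) ∧ ν ∈ G.K n t}

/-! ### Behavioral strategies and equilibria -/

/-- Satisfaction of a vector `π` of payoff distributions, indexed by opponents' types and states:
the most favorable expectation over the admissible priors `p n t × ν`, `ν ∈ Q n t`. -/
def satisfaction (G : Game ι T A W) (n : ι) (t : T n)
    (π : OppType T n → State W → Measure ℝ) : ℝ :=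
  ⨆ ν : G.Q n t, ∑ s, G.p n t s *
    ∫ ω, (∫ x, x ∂(π s ω)) ∂(ν.1 s : Measure (State W))

/-- Payoff distributions when player `n` takes the action `a` and the opponents randomize. -/
def payoffAct (G : Game ι T A W) (n : ι) (t : T n) (a : A n)
    (δ : (m : {m : ι // m ≠ n}) → T m → ProbabilityMeasure (A m)) :
    OppType T n → State W → Measure ℝ := fun s ω =>
  (Measure.pi fun m : {m : ι // m ≠ n} => (δ m (s m) : Measure (A m))).map fun b => G.u n t s a b ω

/-- Payoff distributions when player `n` and the opponents all randomize. -/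
def payoffDist (G : Game ι T A W) (n : ι) (t : T n) (d : ProbabilityMeasure (A n))
    (δ : (m : {m : ι // m ≠ n}) → T m → ProbabilityMeasure (A m)) :
    OppType T n → State W → Measure ℝ := fun s ω =>
  ((d : Measure (A n)).prod (Measure.pi fun m : {m : ι // m ≠ n} => (δ m (s m) : Measure (A m)))).map
    fun x => G.u n t s x.1 x.2 ω

/-- Action-based equilibrium: every type of every player puts full mass on optimal actions. -/
def IsActionEquilibrium (G : Game ι T A W) (δ : (n : ι) → T n → ProbabilityMeasure (A n)) :
    Prop :=
  ∀ (n : ι) (t : T n), (δ n t : Measure (A n))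
    {a | ∀ a' : A n, G.satisfaction n t (G.payoffAct n t a' fun m => δ m) ≤
      G.satisfaction n t (G.payoffAct n t a fun m => δ m)} = 1

/-- Distribution-based equilibrium: every type of every player uses an optimal distribution. -/
def IsDistEquilibrium (G : Game ι T A W) (δ : (n : ι) → T n → ProbabilityMeasure (A n)) :
    Prop :=
  ∀ (n : ι) (t : T n) (d : ProbabilityMeasure (A n)),
    G.satisfaction n t (G.payoffDist n t d fun m => δ m) ≤
      G.satisfaction n t (G.payoffDist n t (δ n t) fun m => δ m)

/-- The pure behavioral-strategy profile given by type-to-action maps. -/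
def pure {ι : Type*} {T : ι → Type*} {A : ι → Set ℝ} (a : (n : ι) → T n → A n) :
    (n : ι) → T n → ProbabilityMeasure (A n) :=
  fun n t => ⟨Measure.dirac (a n t), inferInstance⟩

/-! ### The monotone best-response correspondence -/

/-- Expected payoff-utility under the state distribution `μ`. -/
def v (G : Game ι T A W) (n : ι) (t : T n) (s : OppType T n) (a : A n) (b : OppAct A n)
    (μ : ProbabilityMeasure (State W)) : ℝ :=
  ∫ ω, G.u n t s a b ω ∂(μ : Measure (State W))

/-- Expected payoff-utility under the prior vector `ν`, when opponents follow `α`. -/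
def w (G : Game ι T A W) (n : ι) (t : T n) (a : A n)
    (α : (m : {m : ι // m ≠ n}) → T m → A m)
    (ν : OppType T n → ProbabilityMeasure (State W)) : ℝ :=
  ∑ s, G.p n t s * G.v n t s a (fun m => α m (s m)) (ν s)

/-- Optimistic payoff of the action `a` against pure opponent strategies `α`. -/
def optPayoff (G : Game ι T A W) (n : ι) (t : T n) (a : A n)
    (α : (m : {m : ι // m ≠ n}) → T m → A m) : ℝ :=
  ⨆ ν : G.Q n t, G.w n t a α ν.1

/-- Best-response actions of player `n` with type `t`. -/
def bestAct (G : Game ι T A W) (n : ι) (t : T n)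
    (α : (m : {m : ι // m ≠ n}) → T m → A m) : Set (A n) :=
  {a | ∀ a' : A n, G.optPayoff n t a' α ≤ G.optPayoff n t a α}

variable [∀ n, LinearOrder (T n)]

/-- Monotone best responses of player `n` to monotone strategies of the opponents. -/
def bestResp (G : Game ι T A W) (n : ι) (α : (m : {m : ι // m ≠ n}) → T m →o A m) :
    Set (T n →o A n) :=
  {b | ∀ t, b t ∈ G.bestAct n t fun m => α m}

/-- The monotone best-response correspondence on profiles of monotone strategies. -/
def bestRespProfile (G : Game ι T A W) (a : (n : ι) → T n →o A n) :
    Set ((n : ι) → T n →o A n) :=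
  {a' | ∀ n, a' n ∈ G.bestResp n fun m => a m}

/-- Fixed points of the monotone best-response correspondence. -/
def fixedPoints (G : Game ι T A W) : Set ((n : ι) → T n →o A n) :=
  {a | a ∈ G.bestRespProfile a}

/-! ### Strategic complementarities -/

/-- The monotonicity assumptions on the primitives of the game. -/
structure StrategicComplementarities (G : Game ι T A W) : Prop where
  mono_state : ∀ n t s a b, Monotone (G.u n t s a b)
  incDiff_own : ∀ n, IncDiff fun (a : A n) (y : T n × OppType T n × OppAct A n × State W) =>
    G.u n y.1 y.2.1 a y.2.2.1 y.2.2.2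
  incDiff_state : ∀ n (a : A n),
    IncDiff fun (y : T n × OppType T n × OppAct A n) (ω : State W) => G.u n y.1 y.2.1 a y.2.2 ω
  mono_prob : ∀ n (t₁ t₂ : T n), t₁ ≤ t₂ → ∀ f : OppType T n → ℝ, Monotone f →
    ∑ s, G.p n t₁ s * f s ≤ ∑ s, G.p n t₂ s * f s
  prior_sublattice : ∀ n t s, IsStSublattice (G.prior n t s)
  mono_prior : ∀ n (t₁ t₂ : T n) s, t₁ ≤ t₂ → InducedSetLE (G.prior n t₁ s) (G.prior n t₂ s)

/-- Scenario A: beliefs on opponents' types do not depend on one's own type, and the prior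
vectors are the monotone ones. -/
def ScenarioA (G : Game ι T A W) : Prop :=
  (∀ n (t₁ t₂ : T n), G.p n t₁ = G.p n t₂) ∧
  ∀ n t, G.K n t = {ν | ∀ s₁ s₂ : OppType T n, s₁ ≤ s₂ → StLE (ν s₁) (ν s₂)}

/-- Scenario B: prior sets do not depend on opponents' types, and the prior vectors are the
constant ones. -/
def ScenarioB (G : Game ι T A W) : Prop :=
  (∀ n t (s₁ s₂ : OppType T n), G.prior n t s₁ = G.prior n t s₂) ∧
  ∀ n t, G.K n t = {ν | ∃ μ, ν = fun _ => μ}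

end Game

end Enterprising

end

/-! The heart is that the optimistic payoff has increasing differences between the own action and
the pair (own type, opponents' monotone strategies), although it is a supremum over priors
(`optPayoff_add_le`). Priors chosen separately for a lower and a higher type have a common upper
bound admissible for the higher type (`exists_upper_mem_Q`). Passing to it does not lower the
payoff, which increases in the state, and increases the gain from a higher action. Hence the closed
nonempty sets of optimal actions ascend in the strong set order (`bestAct_mono`), and a Zhou-type
argument over Tarski's theorem makes the fixed points a complete lattice
(`exists_isLUB_fixedPoints`).

For pure profiles both equilibrium notions reduce to optimality of each action: for each prior a
mixture earns an average of action payoffs, so optimism cannot make mixing beat the best action. -/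

/-! ### Lattice fixed points -/

section FixedPoints

/-- Tarski's theorem, in the form of a least pre-fixed point that is fixed. -/
theorem Monotone.exists_isLeast_prefixed {X : Type*} [PartialOrder X]
    (hX : ∀ S : Set X, ∃ x, IsGLB S x) {g : X → X} (hg : Monotone g) :
    ∃ c, IsLeast {x | g x ≤ x} c ∧ g c = c := by
  obtain ⟨c, hc⟩ := hX {x | g x ≤ x}
  have h₁ : g c ≤ c := hc.2 fun x hx => (hg (hc.1 hx)).trans hx
  exact ⟨c, ⟨h₁, hc.1⟩, h₁.antisymm (hc.1 (hg h₁))⟩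

/-- Greatest lower bounds of sets of monotone maps may be taken pointwise. -/
theorem OrderHom.exists_isGLB {X Y : Type*} [Preorder X] [PartialOrder Y]
    (hY : ∀ S : Set Y, ∃ y, IsGLB S y) (S : Set (X →o Y)) : ∃ f, IsGLB S f := by
  choose g hg using fun x => hY ((fun f : X →o Y => f x) '' S)
  have hmono : Monotone g := by
    intro x y hxy
    refine (hg y).2 ?_
    rintro _ ⟨f, hf, rfl⟩
    exact ((hg x).1 ⟨f, hf, rfl⟩).trans (f.monotone hxy)
  refine ⟨⟨g, hmono⟩, fun f hf x => (hg x).1 ⟨f, hf, rfl⟩, fun h hh x => (hg x).2 ?_⟩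
  rintro _ ⟨f, hf, rfl⟩
  exact hh hf x

theorem Pi.exists_isGLB {ι : Type*} {X : ι → Type*} [∀ i, Preorder (X i)]
    (hX : ∀ i (S : Set (X i)), ∃ x, IsGLB S x) (S : Set (∀ i, X i)) : ∃ f, IsGLB S f := by
  choose g hg using fun i => hX i (Function.eval i '' S)
  exact ⟨g, isGLB_pi.2 hg⟩

/-- The lower bounds form a closed, hence compact, set; it contains the least element of the space,
so it has a greatest element. -/
theorem CompactSpace.exists_isGLB {X : Type*} [LinearOrder X] [TopologicalSpace X]
    [OrderClosedTopology X] [CompactSpace X] [Nonempty X] (S : Set X) : ∃ x, IsGLB S x := by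
  have hc : IsClosed (lowerBounds S) := by
    have : lowerBounds S = ⋂ x ∈ S, Set.Iic x := by ext; simp [lowerBounds]
    rw [this]
    exact isClosed_biInter fun _ _ => isClosed_Iic
  obtain ⟨b, hb⟩ := (isCompact_univ (X := X)).exists_isLeast Set.univ_nonempty
  exact hc.isCompact.exists_isGreatest ⟨b, fun x _ => hb.2 (Set.mem_univ x)⟩

theorem exists_isLUB_of_forall_exists_isGLB {X : Type*} [Preorder X]
    (hX : ∀ S : Set X, ∃ x, IsGLB S x) (S : Set X) : ∃ x, IsLUB S x := by
  obtain ⟨x, hx⟩ := hX (upperBounds S)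
  exact ⟨x, fun a ha => hx.2 fun u hu => hu ha, hx.1⟩

variable {ι : Type*} {T A : ι → Type*} [∀ n, Preorder (T n)] [∀ n, LinearOrder (A n)]
  [∀ n, TopologicalSpace (A n)] [∀ n, OrderClosedTopology (A n)] [∀ n, CompactSpace (A n)]
  [∀ n, Nonempty (A n)]

/-- Zhou's theorem for correspondences given by chains of optimal actions: if the closed nonempty
sets `β n t x` increase with `t` and `x` in the strong set order, then every set of fixed points has
a least upper bound among the fixed points. -/
theorem exists_isLUB_fixedPoints (β : ∀ n, T n → (∀ n, T n →o A n) → Set (A n))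
    (hne : ∀ n t x, (β n t x).Nonempty) (hcl : ∀ n t x, IsClosed (β n t x))
    (hmono : ∀ n ⦃t₁ t₂ : T n⦄, t₁ ≤ t₂ → ∀ ⦃x₁ x₂ : ∀ n, T n →o A n⦄, x₁ ≤ x₂ →
      ∀ a₁ ∈ β n t₁ x₁, ∀ a₂ ∈ β n t₂ x₂, a₁ ⊓ a₂ ∈ β n t₁ x₁ ∧ a₁ ⊔ a₂ ∈ β n t₂ x₂)
    (S : Set {x : ∀ n, T n →o A n | ∀ n t, x n t ∈ β n t x}) : ∃ x, IsLUB S x := by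
  have hX : ∀ S : Set (∀ n, T n →o A n), ∃ x, IsGLB S x :=
    Pi.exists_isGLB fun n => OrderHom.exists_isGLB CompactSpace.exists_isGLB
  obtain ⟨b, hb⟩ := exists_isLUB_of_forall_exists_isGLB hX (Subtype.val '' S)
  -- Evaluating at `x ⊔ b` confines the argument to profiles above `b` while keeping a self-map of
  -- the whole lattice.
  have hleast : ∀ (x : ∀ n, T n →o A n) n t,
      ∃ y, IsLeast (β n t (x ⊔ b) ∩ Set.Ici (b n t)) y := by
    intro x n t
    refine ((hcl n t _).inter isClosed_Ici).isCompact.exists_isLeast ?_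
    choose m hm using fun n t => (hcl n t (x ⊔ b)).isCompact.exists_isGreatest (hne n t _)
    have hm_mono : ∀ n, Monotone (m n) := fun n t₁ t₂ ht =>
      le_sup_left.trans ((hm n t₂).2 (hmono n ht le_rfl _ (hm n t₁).1 _ (hm n t₂).1).2)
    -- `b` is a supremum among monotone profiles, so the greatest selection can be compared with it
    -- only because it is monotone in the type.
    have hbm : b ≤ fun n => ⟨m n, hm_mono n⟩ := by
      refine hb.2 ?_
      rintro _ ⟨e, he, rfl⟩ n t
      have hex : e.1 ≤ x ⊔ b := (hb.1 ⟨e, he, rfl⟩).trans le_sup_right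
      exact le_sup_left.trans ((hm n t).2 (hmono n le_rfl hex _ (e.2 n t) _ (hm n t).1).2)
    exact ⟨m n t, (hm n t).1, hbm n t⟩
  choose g hg using hleast
  have hg_le : ∀ ⦃x₁ x₂ : ∀ n, T n →o A n⦄, x₁ ≤ x₂ → ∀ n ⦃t₁ t₂ : T n⦄, t₁ ≤ t₂ →
      g x₁ n t₁ ≤ g x₂ n t₂ := fun x₁ x₂ hx n t₁ t₂ ht =>
    ((hg x₁ n t₁).2 ⟨(hmono n ht (sup_le_sup_right hx b) _ (hg x₁ n t₁).1.1 _ (hg x₂ n t₂).1.1).1,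
      le_inf (hg x₁ n t₁).1.2 (((b n).monotone ht).trans (hg x₂ n t₂).1.2)⟩).trans inf_le_right
  obtain ⟨c, hc, hfix⟩ := Monotone.exists_isLeast_prefixed hX
    (g := fun x n => ⟨g x n, fun _ _ ht => hg_le le_rfl n ht⟩)
    fun x₁ x₂ hx n t => hg_le hx n le_rfl
  have hgc : ∀ n t, g c n t = c n t := fun n t => DFunLike.congr_fun (congrFun hfix n) t
  have hbc : b ≤ c := fun n t => (hg c n t).1.2.trans_eq (hgc n t)
  have hcβ : ∀ n t, c n t ∈ β n t c := by
    intro n t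
    have h := (hg c n t).1.1
    rwa [hgc, sup_eq_left.2 hbc] at h
  -- A fixed point `e` above `S` lies above `b`, so `e n t` competes in the minimum defining `g e n
  -- t`. Thus `e` is pre-fixed and lies above `c`.
  refine ⟨⟨c, hcβ⟩, fun e he => (hb.1 ⟨e, he, rfl⟩).trans hbc, fun e he => hc.2 fun n t => ?_⟩
  have hbe : b ≤ e.1 := by
    refine hb.2 ?_
    rintro _ ⟨e', he', rfl⟩
    exact he he'
  refine (hg e.1 n t).2 ⟨?_, hbe n t⟩
  rw [sup_eq_left.2 hbe]
  exact e.2 n t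

end FixedPoints

/-! ### Stochastic order on the state space -/

namespace Enterprising

theorem FiniteOrInterval.isCompact {s : Set ℝ} (hs : FiniteOrInterval s) : IsCompact s := by
  rcases hs.2 with h | ⟨l, r, rfl⟩
  exacts [h.isCompact, isCompact_Icc]

section StochasticOrder

variable {S : Type*} [MeasurableSpace S] [Preorder S]

/-- On an ordered space with least and greatest elements, measurable monotone functions are
integrable. -/
theorem integrable_of_monotone {b t : S} (hb : IsBot b) (ht : IsTop t) {q : S → ℝ}
    (hq : Monotone q) (hm : Measurable q) (μ : ProbabilityMeasure S) :
    Integrable q (μ : Measure S) :=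
  Integrable.of_mem_Icc (q b) (q t) hm.aemeasurable
    (Filter.Eventually.of_forall fun x => ⟨hq (hb x), hq (ht x)⟩)

theorem StLE.refl (μ : ProbabilityMeasure S) : StLE μ μ := fun _ _ _ _ _ => le_rfl

/-- The order only tests functions integrable under both measures; the extreme elements bound the
test function and so give integrability under the middle one. -/
theorem StLE.trans {b t : S} (hb : IsBot b) (ht : IsTop t) {μ₁ μ₂ μ₃ : ProbabilityMeasure S}
    (h₁ : StLE μ₁ μ₂) (h₂ : StLE μ₂ μ₃) : StLE μ₁ μ₃ := fun q hq hm i₁ i₃ =>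
  have i₂ := integrable_of_monotone hb ht hq hm μ₂
  (h₁ q hq hm i₁ i₂).trans (h₂ q hq hm i₂ i₃)

end StochasticOrder

namespace Game

theorem pi_pure {ι : Type*} [Fintype ι] [DecidableEq ι] {T : ι → Type*} {A : ι → Set ℝ} (n : ι)
    (α : (n : ι) → T n → A n) (s : OppType T n) :
    (Measure.pi fun m : {m : ι // m ≠ n} => (pure α m (s m) : Measure (A m))) =
      Measure.dirac fun m : {m : ι // m ≠ n} => α m (s m) := by
  rw [← Measure.infinitePi_eq_pi]
  exact Measure.infinitePi_dirac fun m : {m : ι // m ≠ n} => α m (s m)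

/-! ### Continuity of the optimistic payoff and existence of optimal actions -/

variable {ι : Type*} [Fintype ι] [DecidableEq ι] {T : ι → Type*} [∀ n, Fintype (T n)]
  {A : ι → Set ℝ} {k : ℕ} {W : Fin k → Set ℝ} (G : Game ι T A W)

theorem compactSpace_act (G : Game ι T A W) (n : ι) : CompactSpace (A n) :=
  isCompact_iff_compactSpace.1 (G.act_shape n).isCompact

theorem exists_isBot_isTop_state (G : Game ι T A W) : ∃ b t : State W, IsBot b ∧ IsTop t := by
  choose b hb using fun i => (G.state_shape i).isCompact.exists_isLeast (G.state_shape i).1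
  choose t ht using fun i => (G.state_shape i).isCompact.exists_isGreatest (G.state_shape i).1
  exact ⟨fun i => ⟨b i, (hb i).1⟩, fun i => ⟨t i, (ht i).1⟩,
    fun x i => (hb i).2 (x i).2, fun x i => (ht i).2 (x i).2⟩

theorem compactSpace_state (G : Game ι T A W) : CompactSpace (State W) :=
  have := fun i => isCompact_iff_compactSpace.1 (G.state_shape i).isCompact
  inferInstance

theorem continuous_u_state (n : ι) (t : T n) (s : OppType T n) (a : A n) (b : OppAct A n) :
    Continuous (G.u n t s a b) :=
  (G.u_cont n t s).comp (by fun_prop : Continuous fun ω => (a, b, ω))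

theorem integrable_u (n : ι) (t : T n) (s : OppType T n) (a : A n) (b : OppAct A n)
    (μ : ProbabilityMeasure (State W)) : Integrable (G.u n t s a b) (μ : Measure (State W)) := by
  have := G.compactSpace_state
  exact BoundedContinuousFunction.integrable (μ : Measure (State W))
    (BoundedContinuousFunction.mkOfCompact ⟨_, G.continuous_u_state n t s a b⟩)

/-- The payoff-utility as a function of the state, seen as a point of `C(State W, ℝ)`. -/
def stateUtility (n : ι) (t : T n) (s : OppType T n) (b : OppAct A n) (a : A n) :
    C(State W, ℝ) := ⟨G.u n t s a b, G.continuous_u_state n t s a b⟩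

theorem continuous_stateUtility (n : ι) (t : T n) (s : OppType T n) (b : OppAct A n) :
    Continuous (G.stateUtility n t s b) := by
  refine ContinuousMap.continuous_of_continuous_uncurry _ ?_
  exact (G.u_cont n t s).comp (by fun_prop : Continuous fun x : A n × State W => (x.1, b, x.2))

theorem v_sub_le [CompactSpace (State W)] (n : ι) (t : T n) (s : OppType T n) (a a' : A n)
    (b : OppAct A n) (μ : ProbabilityMeasure (State W)) :
    G.v n t s a b μ - G.v n t s a' b μ ≤
      dist (G.stateUtility n t s b a) (G.stateUtility n t s b a') := by
  unfold v
  rw [← integral_sub (G.integrable_u n t s a b μ) (G.integrable_u n t s a' b μ)]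
  refine (integral_mono ((G.integrable_u n t s a b μ).sub (G.integrable_u n t s a' b μ))
    (integrable_const (dist (G.stateUtility n t s b a) (G.stateUtility n t s b a')))
    fun ω => ?_).trans_eq (by simp)
  exact (le_abs_self _).trans (ContinuousMap.dist_apply_le_dist (f := G.stateUtility n t s b a)
    (g := G.stateUtility n t s b a') ω)

theorem abs_v_le [CompactSpace (State W)] (n : ι) (t : T n) (s : OppType T n) (a : A n)
    (b : OppAct A n) (μ : ProbabilityMeasure (State W)) :
    |G.v n t s a b μ| ≤ ‖G.stateUtility n t s b a‖ := by
  have := norm_integral_le_of_norm_le_const (μ := (μ : Measure (State W))) (f := G.u n t s a b)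
    (Filter.Eventually.of_forall fun ω => (G.stateUtility n t s b a).norm_coe_le_norm ω)
  simpa [v] using this

/-- Real suprema default to `0` on unbounded families, so this bound is what gives `optPayoff` its
meaning. -/
theorem bddAbove_w (n : ι) (t : T n) (a : A n) (α : (m : {m : ι // m ≠ n}) → T m → A m) :
    BddAbove (Set.range fun ν : G.Q n t => G.w n t a α ν.1) := by
  have := G.compactSpace_state
  refine ⟨∑ s, G.p n t s * ‖G.stateUtility n t s (fun m => α m (s m)) a‖, ?_⟩
  rintro _ ⟨ν, rfl⟩
  exact Finset.sum_le_sum fun s _ => mul_le_mul_of_nonneg_left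
    ((le_abs_self _).trans (G.abs_v_le n t s a _ _)) (G.p_nonneg n t s)

theorem nonempty_Q (n : ι) (t : T n) : Nonempty (G.Q n t) := (G.prior_nonempty n t).to_subtype

theorem w_le_optPayoff (n : ι) (t : T n) (a : A n) (α : (m : {m : ι // m ≠ n}) → T m → A m)
    {ν} (hν : ν ∈ G.Q n t) : G.w n t a α ν ≤ G.optPayoff n t a α :=
  le_ciSup (G.bddAbove_w n t a α) ⟨ν, hν⟩

theorem optPayoff_le {n : ι} {t : T n} {a : A n} {α : (m : {m : ι // m ≠ n}) → T m → A m} {c : ℝ}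
    (h : ∀ ν ∈ G.Q n t, G.w n t a α ν ≤ c) : G.optPayoff n t a α ≤ c :=
  have := G.nonempty_Q n t
  ciSup_le fun ν => h ν.1 ν.2

/-- The sup-norm distance controls the payoff difference uniformly over priors, so the estimate
survives the supremum; continuity in the action follows. -/
theorem optPayoff_sub_le [CompactSpace (State W)] (n : ι) (t : T n) (a a' : A n)
    (α : (m : {m : ι // m ≠ n}) → T m → A m) :
    G.optPayoff n t a α - G.optPayoff n t a' α ≤
      ∑ s, G.p n t s * dist (G.stateUtility n t s (fun m => α m (s m)) a)
        (G.stateUtility n t s (fun m => α m (s m)) a') := by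
  rw [sub_le_iff_le_add]
  refine G.optPayoff_le fun ν hν => ?_
  have h : G.w n t a α ν - G.w n t a' α ν ≤ ∑ s, G.p n t s *
      dist (G.stateUtility n t s (fun m => α m (s m)) a)
        (G.stateUtility n t s (fun m => α m (s m)) a') := by
    unfold w
    rw [← Finset.sum_sub_distrib]
    refine Finset.sum_le_sum fun s _ => ?_
    rw [← mul_sub]
    exact mul_le_mul_of_nonneg_left (G.v_sub_le n t s a a' _ _) (G.p_nonneg n t s)
  linarith [G.w_le_optPayoff n t a' α hν]

theorem continuous_optPayoff (n : ι) (t : T n) (α : (m : {m : ι // m ≠ n}) → T m → A m) :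
    Continuous fun a => G.optPayoff n t a α := by
  have := G.compactSpace_state
  refine continuous_iff_continuousAt.2 fun a => tendsto_iff_dist_tendsto_zero.2 ?_
  have hlim : Filter.Tendsto (fun a' => ∑ s, G.p n t s *
      dist (G.stateUtility n t s (fun m => α m (s m)) a')
        (G.stateUtility n t s (fun m => α m (s m)) a)) (nhds a) (nhds 0) := by
    have hc : Continuous (fun a' => ∑ s, G.p n t s *
      dist (G.stateUtility n t s (fun m => α m (s m)) a')
        (G.stateUtility n t s (fun m => α m (s m)) a)) :=
      continuous_finsetSum _ fun s _ => continuous_const.mul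
        ((G.continuous_stateUtility n t s _).dist continuous_const)
    simpa using hc.tendsto a
  refine squeeze_zero (fun _ => dist_nonneg) (fun a' => ?_) hlim
  rw [Real.dist_eq]
  refine abs_sub_le_iff.2 ⟨G.optPayoff_sub_le n t a' a α, ?_⟩
  simpa only [dist_comm] using G.optPayoff_sub_le n t a a' α

theorem isClosed_bestAct (n : ι) (t : T n) (α : (m : {m : ι // m ≠ n}) → T m → A m) :
    IsClosed (G.bestAct n t α) := by
  simp only [bestAct, Set.ofPred_forall]
  exact isClosed_iInter fun a' => isClosed_le continuous_const (G.continuous_optPayoff n t α)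

theorem nonempty_bestAct (n : ι) (t : T n) (α : (m : {m : ι // m ≠ n}) → T m → A m) :
    (G.bestAct n t α).Nonempty := by
  have := G.compactSpace_act n
  have := (G.act_shape n).1.to_subtype
  obtain ⟨a, -, ha⟩ := isCompact_univ.exists_isMaxOn Set.univ_nonempty
    (G.continuous_optPayoff n t α).continuousOn
  exact ⟨a, fun x => ha (Set.mem_univ x)⟩

/-! ### Pure profiles -/

theorem satisfaction_payoffAct_pure (n : ι) (t : T n) (a : A n) (α : (n : ι) → T n → A n) :
    G.satisfaction n t (G.payoffAct n t a fun m => pure α m) =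
      G.optPayoff n t a fun m => α m := by
  have hmeas : ∀ s ω, Measurable fun b => G.u n t s a b ω := fun s ω =>
    ((G.u_cont n t s).comp (by fun_prop : Continuous fun b => (a, b, ω))).measurable
  have h : ∀ s ω, ∫ x, x ∂(G.payoffAct n t a (fun m => pure α m) s ω) =
      G.u n t s a (fun m => α m (s m)) ω := by
    intro s ω
    rw [payoffAct, pi_pure, Measure.map_dirac' (hmeas s ω), integral_dirac]
  simp only [satisfaction, h, optPayoff, w, v]

theorem integral_payoffDist_pure (n : ι) (t : T n) (d : ProbabilityMeasure (A n))
    (α : (n : ι) → T n → A n) (s : OppType T n) (ω : State W) :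
    ∫ x, x ∂(G.payoffDist n t d (fun m => pure α m) s ω) =
      ∫ a, G.u n t s a (fun m => α m (s m)) ω ∂(d : Measure (A n)) := by
  have hc : Continuous fun x : A n × OppAct A n => G.u n t s x.1 x.2 ω :=
    (G.u_cont n t s).comp (by fun_prop : Continuous fun x : A n × OppAct A n => (x.1, x.2, ω))
  have hc' : Continuous fun a : A n => G.u n t s a (fun m => α m (s m)) ω :=
    hc.comp (by fun_prop : Continuous fun a : A n => (a, fun m : {m : ι // m ≠ n} => α m (s m)))
  -- A product with a Dirac mass is the image of `d` under `a ↦ (a, b)`, so the payoff law is an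
  -- image of `d`.
  rw [payoffDist, pi_pure, Measure.prod_dirac, Measure.map_map hc.measurable (by fun_prop)]
  exact integral_map hc'.measurable.aemeasurable aestronglyMeasurable_id

theorem satisfaction_payoffDist_pure_dirac (n : ι) (t : T n) (a : A n) (α : (n : ι) → T n → A n) :
    G.satisfaction n t (G.payoffDist n t ⟨Measure.dirac a, inferInstance⟩ fun m => pure α m) =
      G.optPayoff n t a fun m => α m := by
  have h : ∀ s ω, ∫ x, x ∂(G.payoffDist n t ⟨Measure.dirac a, inferInstance⟩
      (fun m => pure α m) s ω) = G.u n t s a (fun m => α m (s m)) ω := fun s ω =>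
    (G.integral_payoffDist_pure n t _ α s ω).trans (integral_dirac _ a)
  simp only [satisfaction, h, optPayoff, w, v]

/-- For a fixed prior vector, Fubini turns the value of `d` into a `d`-average of the payoffs `w`,
each at most the optimistic payoff of its action. -/
theorem satisfaction_payoffDist_pure_le (n : ι) (t : T n) (d : ProbabilityMeasure (A n))
    (α : (n : ι) → T n → A n) {c : ℝ} (hc : ∀ a, G.optPayoff n t a (fun m => α m) ≤ c) :
    G.satisfaction n t (G.payoffDist n t d fun m => pure α m) ≤ c := by
  have := G.nonempty_Q n t
  have := G.compactSpace_state
  have := G.compactSpace_act n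
  have h : ∀ s ω, ∫ x, x ∂(G.payoffDist n t d (fun m => pure α m) s ω) =
      ∫ a, G.u n t s a (fun m => α m (s m)) ω ∂(d : Measure (A n)) :=
    G.integral_payoffDist_pure n t d α
  simp only [satisfaction, h]
  refine ciSup_le fun ν => ?_
  have hint : ∀ s, Integrable (fun x : A n × State W => G.u n t s x.1 (fun m => α m (s m)) x.2)
      ((d : Measure (A n)).prod (ν.1 s : Measure (State W))) := fun s =>
    BoundedContinuousFunction.integrable _ (BoundedContinuousFunction.mkOfCompact
      ⟨_, (G.u_cont n t s).comp
        (by fun_prop : Continuous fun x : A n × State W => (x.1, fun m : {m : ι // m ≠ n} => α m (s m), x.2))⟩)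
  have hswap : ∀ s, ∫ ω, ∫ a, G.u n t s a (fun m => α m (s m)) ω ∂(d : Measure (A n))
      ∂(ν.1 s : Measure (State W)) =
      ∫ a, G.v n t s a (fun m => α m (s m)) (ν.1 s) ∂(d : Measure (A n)) := fun s =>
    (integral_integral_swap (hint s)).symm
  simp only [hswap, ← integral_const_mul]
  have hi : ∀ s, Integrable (fun a => G.p n t s * G.v n t s a (fun m => α m (s m)) (ν.1 s))
      (d : Measure (A n)) := fun s => (hint s).integral_prod_left.const_mul _
  rw [← integral_finsetSum _ fun s _ => hi s]
  refine (integral_mono (integrable_finsetSum _ fun s _ => hi s) (integrable_const c)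
    fun a => ?_).trans_eq (by simp)
  exact (G.w_le_optPayoff n t a (fun m => α m) ν.2).trans (hc a)

theorem isActionEquilibrium_pure_iff (α : (n : ι) → T n → A n) :
    G.IsActionEquilibrium (pure α) ↔ ∀ n t, α n t ∈ G.bestAct n t fun m => α m := by
  refine forall₂_congr fun n t => ?_
  have h : ∀ a, G.satisfaction n t (G.payoffAct n t a fun m => pure α m) =
      G.optPayoff n t a fun m => α m := fun a => G.satisfaction_payoffAct_pure n t a α
  simp only [h]
  change Measure.dirac (α n t) (G.bestAct n t fun m => α m) = 1 ↔ _
  rw [Measure.dirac_apply, Set.indicator_eq_one_iff_mem]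

theorem isDistEquilibrium_pure_iff (α : (n : ι) → T n → A n) :
    G.IsDistEquilibrium (pure α) ↔ ∀ n t, α n t ∈ G.bestAct n t fun m => α m := by
  refine forall₂_congr fun n t => ?_
  have h : ∀ a, G.satisfaction n t (G.payoffDist n t ⟨Measure.dirac a, inferInstance⟩
      fun m => pure α m) = G.optPayoff n t a fun m => α m :=
    fun a => G.satisfaction_payoffDist_pure_dirac n t a α
  have hα : G.satisfaction n t (G.payoffDist n t (pure α n t) fun m => pure α m) =
      G.optPayoff n t (α n t) fun m => α m := h _
  rw [hα]
  exact ⟨fun hd a => (h a).symm.trans_le (hd _),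
    fun ha d => G.satisfaction_payoffDist_pure_le n t d α ha⟩

/-! ### Monotone comparative statics -/

section Monotone

variable [∀ n, LinearOrder (T n)] {G}

/-- Along `a₁ ≤ a₂`, the gain in expected payoff-utility increases with the own type, the
opponents' strategies and the prior vector. -/
theorem StrategicComplementarities.w_sub_le_w_sub (hG : G.StrategicComplementarities) {n : ι}
    {t₁ t₂ : T n} (ht : t₁ ≤ t₂) {a₁ a₂ : A n} (ha : a₁ ≤ a₂)
    {α β : (m : {m : ι // m ≠ n}) → T m → A m} (hα : ∀ m, Monotone (α m)) (hαβ : α ≤ β)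
    {ν₁ ν₂ : OppType T n → ProbabilityMeasure (State W)}
    (hν₁ : ∀ s₁ s₂ : OppType T n, s₁ ≤ s₂ → StLE (ν₁ s₁) (ν₁ s₂))
    (hν : ∀ s, StLE (ν₁ s) (ν₂ s)) :
    G.w n t₁ a₂ α ν₁ - G.w n t₁ a₁ α ν₁ ≤ G.w n t₂ a₂ β ν₂ - G.w n t₂ a₁ β ν₂ := by
  have hw : ∀ t (γ : (m : {m : ι // m ≠ n}) → T m → A m) ν,
      G.w n t a₂ γ ν - G.w n t a₁ γ ν = ∑ s, G.p n t s *
        (G.v n t s a₂ (fun m => γ m (s m)) (ν s) - G.v n t s a₁ (fun m => γ m (s m)) (ν s)) := by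
    intro t γ ν
    simp only [w, mul_sub, Finset.sum_sub_distrib]
  have hv : ∀ {t t' : T n} {s s' : OppType T n} {b b' : OppAct A n}
      {μ μ' : ProbabilityMeasure (State W)}, t ≤ t' → s ≤ s' → b ≤ b' → StLE μ μ' →
      G.v n t s a₂ b μ - G.v n t s a₁ b μ ≤ G.v n t' s' a₂ b' μ' - G.v n t' s' a₁ b' μ' := by
    intro t t' s s' b b' μ μ' ht hs hb hμ
    have hi : ∀ t s b (ρ : ProbabilityMeasure (State W)),
        Integrable (fun ω => G.u n t s a₂ b ω - G.u n t s a₁ b ω) (ρ : Measure (State W)) :=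
      fun t s b ρ => (G.integrable_u n t s a₂ b ρ).sub (G.integrable_u n t s a₁ b ρ)
    have hv' : ∀ t s b ρ, G.v n t s a₂ b ρ - G.v n t s a₁ b ρ =
        ∫ ω, (G.u n t s a₂ b ω - G.u n t s a₁ b ω) ∂(ρ : Measure (State W)) :=
      fun t s b ρ => (integral_sub (G.integrable_u n t s a₂ b ρ) (G.integrable_u n t s a₁ b ρ)).symm
    have hD : ∀ {t t' : T n} {s s' : OppType T n} {b b' : OppAct A n} {ω ω' : State W},
        t ≤ t' → s ≤ s' → b ≤ b' → ω ≤ ω' →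
        G.u n t s a₂ b ω - G.u n t s a₁ b ω ≤ G.u n t' s' a₂ b' ω' - G.u n t' s' a₁ b' ω' :=
      fun {t t' s s' b b' ω ω'} h₁ h₂ h₃ h₄ =>
        hG.incDiff_own n ha (y₁ := (t, s, b, ω)) (y₂ := (t', s', b', ω')) ⟨h₁, h₂, h₃, h₄⟩
    rw [hv', hv']
    refine (hμ _ (fun ω ω' hω => hD le_rfl le_rfl le_rfl hω)
      ((G.continuous_u_state n t s a₂ b).sub (G.continuous_u_state n t s a₁ b)).measurable
      (hi t s b μ) (hi t s b μ')).trans ?_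
    exact integral_mono (hi t s b μ') (hi t' s' b' μ') fun ω => hD ht hs hb le_rfl
  rw [hw, hw]
  -- The beliefs move from `t₁` to `t₂` first, with the integrand frozen; it increases in `s`
  -- because `α` and `ν₁` do. The integrand then moves term by term.
  refine (hG.mono_prob n t₁ t₂ ht _ fun s s' hs =>
    hv le_rfl hs (fun m => hα m (hs m)) (hν₁ s s' hs)).trans ?_
  exact Finset.sum_le_sum fun s _ => mul_le_mul_of_nonneg_left
    (hv ht le_rfl (fun m => hαβ m (s m)) (hν s)) (G.p_nonneg n t₂ s)

theorem StrategicComplementarities.w_mono (hG : G.StrategicComplementarities) {n : ι}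
    (t : T n) (a : A n) (α : (m : {m : ι // m ≠ n}) → T m → A m)
    {ν₁ ν₂ : OppType T n → ProbabilityMeasure (State W)} (hν : ∀ s, StLE (ν₁ s) (ν₂ s)) :
    G.w n t a α ν₁ ≤ G.w n t a α ν₂ :=
  Finset.sum_le_sum fun s _ => mul_le_mul_of_nonneg_left
    (hν s _ (hG.mono_state n t s a _) (G.continuous_u_state n t s a _).measurable
      (G.integrable_u n t s a _ _) (G.integrable_u n t s a _ _)) (G.p_nonneg n t s)

/-- In either scenario the admissible prior vectors are monotone in the opponents' types. -/
theorem stLE_of_mem_Q (hAB : G.ScenarioA ∨ G.ScenarioB) {n : ι} {t : T n}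
    {ν : OppType T n → ProbabilityMeasure (State W)} (hν : ν ∈ G.Q n t)
    {s₁ s₂ : OppType T n} (hs : s₁ ≤ s₂) : StLE (ν s₁) (ν s₂) := by
  obtain ⟨-, hK⟩ := hν
  rcases hAB with h | h
  · rw [h.2 n t] at hK
    exact hK s₁ s₂ hs
  · rw [h.2 n t] at hK
    obtain ⟨μ, rfl⟩ := hK
    exact StLE.refl μ

/-- In either scenario, admissible prior vectors of a lower and a higher type have a common upper
bound that is admissible for the higher type. -/
theorem StrategicComplementarities.exists_upper_mem_Q (hG : G.StrategicComplementarities)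
    (hAB : G.ScenarioA ∨ G.ScenarioB) {n : ι} {t₁ t₂ : T n} (ht : t₁ ≤ t₂)
    {ν₁ ν₂ : OppType T n → ProbabilityMeasure (State W)} (hν₁ : ν₁ ∈ G.Q n t₁)
    (hν₂ : ν₂ ∈ G.Q n t₂) :
    ∃ ν ∈ G.Q n t₂, (∀ s, StLE (ν₁ s) (ν s)) ∧ ∀ s, StLE (ν₂ s) (ν s) := by
  obtain ⟨b, t, hb, ht'⟩ := G.exists_isBot_isTop_state
  choose j hj hjoin using fun s => (hG.mono_prior n t₁ t₂ s ht _ (hν₁.1 s) _ (hν₂.1 s)).2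
  rcases hAB with h | h
  · refine ⟨j, ⟨hj, ?_⟩, fun s => (hjoin s).1, fun s => (hjoin s).2.1⟩
    rw [h.2 n t₂]
    -- The join at `s'` bounds both priors at `s`, hence dominates their least upper bound.
    exact fun s s' hs => (hjoin s).2.2 _
      ((stLE_of_mem_Q (.inl h) hν₁ hs).trans hb ht' (hjoin s').1)
      ((stLE_of_mem_Q (.inl h) hν₂ hs).trans hb ht' (hjoin s').2.1)
  · obtain ⟨hp₁, hK₁⟩ := hν₁
    obtain ⟨hp₂, hK₂⟩ := hν₂
    rw [h.2 n t₁] at hK₁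
    rw [h.2 n t₂] at hK₂
    obtain ⟨μ₁, rfl⟩ := hK₁
    obtain ⟨μ₂, rfl⟩ := hK₂
    rcases isEmpty_or_nonempty (OppType T n) with he | ⟨⟨s₀⟩⟩
    · exact ⟨fun _ => μ₂, ⟨hp₂, by rw [h.2 n t₂]; exact ⟨μ₂, rfl⟩⟩, he.elim, he.elim⟩
    -- One join serves all opponents' types, since the prior sets do not depend on them.
    · refine ⟨fun _ => j s₀, ⟨fun s => h.1 n t₂ s₀ s ▸ hj s₀, ?_⟩,
        fun s => (hjoin s₀).1, fun s => (hjoin s₀).2.1⟩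
      rw [h.2 n t₂]
      exact ⟨j s₀, rfl⟩

/-- The optimistic payoff has increasing differences between the own action and the pair formed by
the own type and the opponents' monotone strategies. -/
theorem StrategicComplementarities.optPayoff_add_le (hG : G.StrategicComplementarities)
    (hAB : G.ScenarioA ∨ G.ScenarioB) {n : ι} {t₁ t₂ : T n} (ht : t₁ ≤ t₂) {a₁ a₂ : A n}
    (ha : a₁ ≤ a₂) {α β : (m : {m : ι // m ≠ n}) → T m → A m} (hα : ∀ m, Monotone (α m))
    (hαβ : α ≤ β) :
    G.optPayoff n t₁ a₂ α + G.optPayoff n t₂ a₁ β ≤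
      G.optPayoff n t₁ a₁ α + G.optPayoff n t₂ a₂ β := by
  rw [← le_sub_iff_add_le]
  refine G.optPayoff_le fun ν₁ hν₁ => ?_
  rw [le_sub_comm]
  refine G.optPayoff_le fun ν₂ hν₂ => ?_
  -- `ν` dominates `ν₁` for the comparison of gains and `ν₂` for monotonicity in the state.
  obtain ⟨ν, hν, h₁, h₂⟩ := hG.exists_upper_mem_Q hAB ht hν₁ hν₂
  have hdiff := hG.w_sub_le_w_sub ht ha hα hαβ (fun s s' hs => stLE_of_mem_Q hAB hν₁ hs) h₁
  linarith [hG.w_mono t₂ a₁ β h₂, G.w_le_optPayoff n t₁ a₁ α hν₁, G.w_le_optPayoff n t₂ a₂ β hν]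

/-- Best-response actions increase, in the strong set order, with the own type and the opponents'
monotone strategies. -/
theorem StrategicComplementarities.bestAct_mono (hG : G.StrategicComplementarities)
    (hAB : G.ScenarioA ∨ G.ScenarioB) {n : ι} {t₁ t₂ : T n} (ht : t₁ ≤ t₂)
    {α β : (m : {m : ι // m ≠ n}) → T m → A m} (hα : ∀ m, Monotone (α m)) (hαβ : α ≤ β)
    {a₁ a₂ : A n} (h₁ : a₁ ∈ G.bestAct n t₁ α) (h₂ : a₂ ∈ G.bestAct n t₂ β) :
    a₁ ⊓ a₂ ∈ G.bestAct n t₁ α ∧ a₁ ⊔ a₂ ∈ G.bestAct n t₂ β := by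
  rcases le_total a₁ a₂ with h | h
  · rw [inf_eq_left.2 h, sup_eq_right.2 h]
    exact ⟨h₁, h₂⟩
  · rw [inf_eq_right.2 h, sup_eq_left.2 h]
    -- With `a₂ ≤ a₁`, swapping the two actions between the types does not lower the total payoff,
    -- so both swapped actions are optimal.
    have hd := hG.optPayoff_add_le hAB ht h hα hαβ
    exact ⟨fun a => (h₁ a).trans (by linarith [h₂ a₁]), fun a => (h₂ a).trans (by linarith [h₁ a₂])⟩

theorem StrategicComplementarities.exists_isLUB_fixedPoints (hG : G.StrategicComplementarities)
    (hAB : G.ScenarioA ∨ G.ScenarioB) (S : Set G.fixedPoints) : ∃ x, IsLUB S x := by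
  have := G.compactSpace_act
  have := fun n => (G.act_shape n).1.to_subtype
  exact _root_.exists_isLUB_fixedPoints
    (fun n t (x : ∀ n, T n →o A n) => G.bestAct n t fun m => x m)
    (fun n t x => G.nonempty_bestAct n t _) (fun n t x => G.isClosed_bestAct n t _)
    (fun n t₁ t₂ ht x₁ x₂ hx a₁ h₁ a₂ h₂ =>
      hG.bestAct_mono hAB ht (fun m => (x₁ m).monotone) (fun m => hx m) h₁ h₂) S

end Monotone

end Game

end Enterprising

/-! ### The equilibrium lattice -/

theorem theorem7 {ι : Type*} [Fintype ι] [DecidableEq ι] {T : ι → Type*}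
    [∀ n, Fintype (T n)] [∀ n, LinearOrder (T n)] [∀ n, Nonempty (T n)]
    {A : ι → Set ℝ} {k : ℕ} {W : Fin k → Set ℝ}
    (G : Enterprising.Game ι T A W)
    (hG : G.StrategicComplementarities)
    (hAB : G.ScenarioA ∨ G.ScenarioB) :
    -- the fixed points form a nonempty complete lattice in the induced order
    G.fixedPoints.Nonempty ∧
    (∀ S : Set G.fixedPoints, (∃ x, IsLUB S x) ∧ (∃ x, IsGLB S x)) ∧
    -- they are exactly the pure and type-monotone equilibria, in both senses
    (∀ a : (n : ι) → T n →o A n,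
      (a ∈ G.fixedPoints ↔ G.IsActionEquilibrium (Enterprising.Game.pure fun n => a n)) ∧
      (a ∈ G.fixedPoints ↔ G.IsDistEquilibrium (Enterprising.Game.pure fun n => a n))) ∧
    -- there are a smallest and a largest one
    (∃ a, IsLeast G.fixedPoints a) ∧ (∃ a, IsGreatest G.fixedPoints a) := by
  have hLUB : ∀ S : Set G.fixedPoints, ∃ x, IsLUB S x := hG.exists_isLUB_fixedPoints hAB
  have hGLB : ∀ S : Set G.fixedPoints, ∃ x, IsGLB S x :=
    exists_isLUB_of_forall_exists_isGLB (X := G.fixedPointsᵒᵈ) hLUB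
  -- The supremum of the empty set is the smallest fixed point, which also gives nonemptiness.
  obtain ⟨x, hx⟩ := hLUB ∅
  obtain ⟨y, hy⟩ := hLUB Set.univ
  refine ⟨⟨x, x.2⟩, fun S => ⟨hLUB S, hGLB S⟩, fun a => ⟨?_, ?_⟩,
    ⟨x, x.2, fun e he => @hx.2 ⟨e, he⟩ (by simp)⟩,
    ⟨y, y.2, fun e he => hy.1 (Set.mem_univ (⟨e, he⟩ : G.fixedPoints))⟩⟩
  · exact (G.isActionEquilibrium_pure_iff fun n => a n).symm
  · exact (G.isDistEquilibrium_pure_iff fun n => a n).symm
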